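/- There exists a constant $c$ such that the following holds. Let $k\ge 3$ be an integer and let $\vec H$ be an acyclic orientation of the cycle $C_k$ on $k$ vertices. Then the oriented Ramsey number $\vec R(\vec H)$ is finite and $$\vec R(\vec H)\le 2\,(2k)^{c\log^2 k}.$$ Here an orientation of a simple graph replaces each edge $\{u,v\}$ by exactly one of the ordered pairs $(u,v)$, $(v,u)$; it is acyclic if it has no directed cycle; and $\vec R(\vec H)$ is the least $n$ for which there is a simple graph $G$ on $n$ vertices such that every orientation of $G$ contains a (not necessarily induced) copy of $\vec H$. The logarithm is natural, and $\log^2 k=(\log k)^2$. -/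

import Mathlib

namespace OrientedRamsey

/-- `D` is an oriented graph: no two vertices are joined by edges in both directions, and (taking
`u = v`) there are no loops. -/
def IsOriented {V : Type*} (D : Digraph V) : Prop :=
  ∀ u v : V, D.Adj u v → ¬ D.Adj v u

/-- `D` is an orientation of the graph `G`. -/
def IsOrientationOf {V : Type*} (D : Digraph V) (G : SimpleGraph V) : Prop :=
  IsOriented D ∧ ∀ u v : V, G.Adj u v ↔ D.Adj u v ∨ D.Adj v u

/-- `D` is acyclic: no directed walk of positive length returns to its starting vertex. -/
def IsAcyclic {V : Type*} (D : Digraph V) : Prop :=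
  ∀ v : V, ¬ Relation.TransGen D.Adj v v

/-- `D` contains a (not necessarily induced) copy of `H`. -/
def ContainsCopy {V W : Type*} (D : Digraph V) (H : Digraph W) : Prop :=
  ∃ f : W ↪ V, ∀ u v : W, H.Adj u v → D.Adj (f u) (f v)

/-- Every orientation of the graph `G` contains a copy of `H`. -/
def Arrows {V W : Type*} (G : SimpleGraph V) (H : Digraph W) : Prop :=
  ∀ D : Digraph V, IsOrientationOf D G → ContainsCopy D H

/-- The set of all `n` such that some graph `G` on `n` vertices arrows `H`. -/
def ramseySet {W : Type*} (H : Digraph W) : Set ℕ :=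
  {n | ∃ G : SimpleGraph (Fin n), Arrows G H}

/-- The oriented Ramsey number: the infimum of `ramseySet H`. It has a meaning only where that set
is nonempty (the infimum in `ℕ` of the empty set is `0` by convention). -/
noncomputable def ramseyNumber {W : Type*} (H : Digraph W) : ℕ :=
  sInf (ramseySet H)

end OrientedRamsey

/-!
Complete graphs already give a quadratic bound: every tournament `D` on `2 (k - 1)²` vertices
contains every acyclic orientation `H` of the cycle on `k` vertices.

Since `H` is acyclic and finite, it has a source `s`, and deleting `s` leaves an oriented path on
`k - 1` vertices. Some vertex `v` of `D` has at least `(k - 1)²` out-neighbours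
(`exists_outdegree_ge`), and the subtournament induced on them contains every oriented path on
`k - 1` vertices (`exists_path`). Both ends of the path found there are out-neighbours of `v`, so
placing `s` at `v` closes it to a copy of `H`.

For the paths one adds vertices at the end one at a time. At most `2m` vertices of a tournament
have out-degree less than `m` (`card_outdegree_lt`), and likewise for in-degrees; a path on `m`
vertices that avoids these can be continued at its end in the required direction, so that `m²`
vertices suffice for a path on `m` vertices. Finally `2 (k - 1)² ≤ 2 (2 k)²`, and `2 ≤ 2 log² k`
for `k ≥ 3`.
-/

namespace OrientedRamsey

open Finset

/-- The total out-degree and the total in-degree of `R` inside `B` agree, and together they count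
every pair of distinct vertices twice; so some vertex has at least the average out-degree
`(#B - 1) / 2`. -/
lemma exists_outdegree_ge {V : Type*} [DecidableEq V] {R : V → V → Prop} [DecidableRel R]
    (hR : ∀ u v, u ≠ v → R u v ∨ R v u) {m : ℕ} {B : Finset V} (hB : 2 * m ≤ #B)
    (hne : B.Nonempty) : ∃ v ∈ B, m ≤ #{w ∈ B | w ≠ v ∧ R v w} := by
  by_contra! hlt
  have hcount : ∑ v ∈ B, #{w ∈ B | w ≠ v ∧ R v w} = ∑ v ∈ B, #{w ∈ B | w ≠ v ∧ R w v} := by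
    have := sum_card_bipartiteAbove_eq_sum_card_bipartiteBelow (s := B) (t := B)
      (fun v w => w ≠ v ∧ R v w)
    simpa only [bipartiteAbove, bipartiteBelow, ne_comm] using this
  have hdeg : ∀ v ∈ B, #B ≤ #{w ∈ B | w ≠ v ∧ R v w} + #{w ∈ B | w ≠ v ∧ R w v} + 1 := by
    intro v hv
    rw [← card_erase_add_one hv]
    gcongr
    refine (card_le_card fun w hw => ?_).trans (card_union_le _ _)
    have hw := mem_erase.1 hw
    have := hR v w hw.1.symm
    simp only [mem_union, mem_filter]
    tauto
  have h₁ : #B * #B ≤ ∑ v ∈ B,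
      (#{w ∈ B | w ≠ v ∧ R v w} + #{w ∈ B | w ≠ v ∧ R w v} + 1) := by
    simpa using card_nsmul_le_sum B _ _ hdeg
  have h₂ : ∑ v ∈ B, (#{w ∈ B | w ≠ v ∧ R v w} + 1) ≤ #B * m := by
    simpa using sum_le_card_nsmul B (fun v => #{w ∈ B | w ≠ v ∧ R v w} + 1) m hlt
  have hpos : 0 < #B := hne.card_pos
  simp only [sum_add_distrib, sum_const, smul_eq_mul, mul_one] at h₁ h₂
  nlinarith

lemma card_outdegree_lt {V : Type*} [DecidableEq V] {R : V → V → Prop} [DecidableRel R]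
    (hR : ∀ u v, u ≠ v → R u v ∨ R v u) {m : ℕ} (S : Finset V) :
    #{v ∈ S | #{w ∈ S | w ≠ v ∧ R v w} < m} ≤ 2 * m := by
  by_contra! hlt
  obtain ⟨v, hv, hm⟩ := exists_outdegree_ge hR hlt.le (card_pos.1 (by omega))
  refine (mem_filter.1 hv).2.not_ge (hm.trans (card_le_card ?_))
  exact filter_subset_filter _ (filter_subset _ _)

/-- A tournament on `(m + 1)²` vertices contains every oriented path on `m + 1` vertices. The
orientation is encoded by a relation `R i` for each step `i` of the path: the edge relation of the
tournament for a forward edge, its converse for a backward edge. -/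
lemma exists_path {V : Type*} {R : ℕ → V → V → Prop}
    (hR : ∀ i u v, u ≠ v → R i u v ∨ R i v u) (m : ℕ) (S : Finset V) (hS : (m + 1) ^ 2 ≤ #S) :
    ∃ f : ℕ → V, (∀ i ≤ m, f i ∈ S) ∧ Set.InjOn f (Set.Iic m) ∧
      ∀ i < m, R i (f i) (f (i + 1)) := by
  classical
  induction m generalizing S with
  | zero =>
    obtain ⟨v, hv⟩ := card_pos.1 (by omega : 0 < #S)
    refine ⟨fun _ => v, fun _ _ => hv, fun a ha b hb _ => ?_, by simp⟩
    simp only [Set.mem_Iic] at ha hb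
    omega
  | succ m ih =>
    obtain ⟨f, hfS, hinj, hf⟩ := ih {v ∈ S | ¬ #{w ∈ S | w ≠ v ∧ R m v w} < m + 1} (by
      have h₁ := card_outdegree_lt (hR m) (m := m + 1) S
      have h₂ := card_filter_add_card_filter_not (s := S)
        (fun v => #{w ∈ S | w ≠ v ∧ R m v w} < m + 1)
      nlinarith)
    simp only [mem_filter, not_lt] at hfS
    -- At most `m` of the `m + 1` out-neighbours of the last vertex are already on the path.
    obtain ⟨w, hw, hwf⟩ : ∃ w ∈ {w ∈ S | w ≠ f m ∧ R m (f m) w}, w ∉ (range m).image f :=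
      exists_mem_notMem_of_card_lt_card <| by
        have h₁ : #((range m).image f) ≤ m := card_image_le.trans (card_range m).le
        have h₂ := (hfS m le_rfl).2
        omega
    simp only [mem_filter] at hw
    have hfresh : ∀ i ≤ m, f i ≠ w := by
      rintro i hi rfl
      rcases hi.lt_or_eq with h | rfl
      · exact hwf (mem_image_of_mem f (mem_range.2 h))
      · exact hw.2.1 rfl
    refine ⟨fun i => if i ≤ m then f i else w, fun i _ => ?_, fun a ha b hb hab => ?_,
      fun i hi => ?_⟩
    · dsimp only
      split_ifs with h
      exacts [(hfS i h).1, hw.1]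
    · simp only [Set.mem_Iic] at ha hb
      dsimp only at hab
      split_ifs at hab with h₁ h₂ h₂
      · exact hinj h₁ h₂ hab
      · exact absurd hab (hfresh a h₁)
      · exact absurd hab.symm (hfresh b h₂)
      · omega
    · dsimp only
      rcases (Nat.lt_succ_iff.1 hi).lt_or_eq with h | rfl
      · rw [if_pos h.le, if_pos (by omega)]
        exact hf i h
      · rw [if_pos le_rfl, if_neg (by omega)]
        exact hw.2.2

lemma IsAcyclic.exists_source {V : Type*} [Finite V] [Nonempty V] {H : Digraph V}
    (hH : IsAcyclic H) :
    ∃ s, ∀ u, ¬ H.Adj u s := by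
  have : Std.Irrefl (Relation.TransGen H.Adj) := ⟨hH⟩
  obtain ⟨s, -, hs⟩ := (Finite.wellFounded_of_trans_of_irrefl
    (Relation.TransGen H.Adj)).has_min Set.univ Set.univ_nonempty
  exact ⟨s, fun u hu => hs u trivial (.single hu)⟩

theorem arrows_top_of_isAcyclic_cycleGraph {m : ℕ} {H : Digraph (Fin (m + 2))}
    (hH : IsOrientationOf H (SimpleGraph.cycleGraph (m + 2))) (hac : IsAcyclic H) :
    Arrows (⊤ : SimpleGraph (Fin (2 * (m + 1) ^ 2))) H := by
  classical
  intro D hD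
  have htot : ∀ u v, u ≠ v → D.Adj u v ∨ D.Adj v u := fun u v huv => (hD.2 u v).1 huv
  obtain ⟨s, hs⟩ := hac.exists_source
  obtain ⟨v, -, hv⟩ := exists_outdegree_ge htot (m := (m + 1) ^ 2) (B := univ) (by simp)
    (card_pos.1 (by simp))
  -- Vertices of `H` are written `a + s`; the edge of the path between the vertices with `a = i + 1`
  -- and `a = i + 2` is forward if `E i`, backward if `E' i`.
  let E : ℕ → Prop := fun i =>
    ∃ a b : Fin (m + 2), a.val = i + 1 ∧ b.val = i + 2 ∧ H.Adj (a + s) (b + s)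
  let E' : ℕ → Prop := fun i =>
    ∃ a b : Fin (m + 2), a.val = i + 1 ∧ b.val = i + 2 ∧ H.Adj (b + s) (a + s)
  have hE : ∀ i, E i → ¬ E' i := by
    rintro i ⟨a, b, ha, hb, hab⟩ ⟨a', b', ha', hb', hab'⟩
    obtain rfl : a = a' := Fin.ext (ha.trans ha'.symm)
    obtain rfl : b = b' := Fin.ext (hb.trans hb'.symm)
    exact hH.1 _ _ hab hab'
  obtain ⟨f, hfS, hinj, hf⟩ := exists_path
    (R := fun i x y => (E i → D.Adj x y) ∧ (E' i → D.Adj y x))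
    (fun i x y hxy => by
      by_cases h : E i
      · simpa [h, hE i h] using htot x y hxy
      · simpa [h, or_iff_not_imp_left] using fun _ h' _ => (htot x y hxy).resolve_right h')
    m _ hv
  simp only [mem_filter, mem_univ, true_and] at hfS
  let F : Fin (m + 2) → Fin (2 * (m + 1) ^ 2) := Fin.cons v fun i => f i
  have hF : Function.Injective F := by
    refine Fin.cons_injective_iff.2 ⟨?_, fun i j hij => ?_⟩
    · rintro ⟨i, hi⟩
      exact (hfS i (by omega)).1 hi
    · exact Fin.ext (hinj (Set.mem_Iic.2 (by omega)) (Set.mem_Iic.2 (by omega)) hij)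
  have hsucc : ∀ i j : Fin (m + 1), i.succ = j.succ + 1 → i.val = j.val + 1 := by
    intro i j h
    have hval := congrArg Fin.val h
    rw [Fin.val_add_one] at hval
    split_ifs at hval
    all_goals simp only [Fin.val_succ] at hval; omega
  have hadj : ∀ a b, H.Adj (a + s) (b + s) → D.Adj (F a) (F b) := by
    intro a b hab
    have hcyc := (SimpleGraph.cycleGraph_adj.1 ((hH.2 _ _).2 (.inl hab)))
    simp only [add_sub_add_right_eq_sub, sub_eq_iff_eq_add'] at hcyc
    induction b using Fin.cases with
    | zero => exact absurd (by simpa using hab) (hs (a + s))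
    | succ j =>
      induction a using Fin.cases with
      | zero => simpa [F] using (hfS j (by omega)).2
      | succ i =>
        simp only [F, Fin.cons_succ]
        rcases hcyc with h | h
        · have hij := hsucc i j h
          rw [hij]
          exact (hf j (by omega)).2 ⟨j.succ, i.succ, by simp, by simp [hij], hab⟩
        · have hij := hsucc j i h
          rw [hij]
          exact (hf i (by omega)).1 ⟨i.succ, j.succ, by simp, by simp [hij], hab⟩
  refine ⟨⟨fun u => F (u - s), hF.comp sub_left_injective⟩,
    fun u w huw => hadj (u - s) (w - s) ?_⟩
  simpa using huw

end OrientedRamsey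

theorem mainTheorem4 :
    ∃ c : ℝ, ∀ k : ℕ, 3 ≤ k → ∀ H : Digraph (Fin k),
      OrientedRamsey.IsOrientationOf H (SimpleGraph.cycleGraph k) →
      OrientedRamsey.IsAcyclic H →
        (OrientedRamsey.ramseySet H).Nonempty ∧
        (OrientedRamsey.ramseyNumber H : ℝ) ≤
          2 * (2 * (k : ℝ)) ^ (c * (Real.log (k : ℝ)) ^ 2) := by
  refine ⟨2, fun k hk H hH hac => ?_⟩
  obtain ⟨m, rfl⟩ : ∃ m, k = m + 2 := ⟨k - 2, by omega⟩
  have hmem : 2 * (m + 1) ^ 2 ∈ OrientedRamsey.ramseySet H :=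
    ⟨⊤, OrientedRamsey.arrows_top_of_isAcyclic_cycleGraph hH hac⟩
  refine ⟨⟨_, hmem⟩, ?_⟩
  have hk' : (3 : ℝ) ≤ ((m + 2 : ℕ) : ℝ) := by exact_mod_cast hk
  have hlog : 1 ≤ Real.log ((m + 2 : ℕ) : ℝ) := by
    rw [Real.le_log_iff_exp_le (by linarith)]
    linarith [Real.exp_one_lt_d9]
  calc (OrientedRamsey.ramseyNumber H : ℝ) ≤ ((2 * (m + 1) ^ 2 : ℕ) : ℝ) := by
        exact_mod_cast Nat.sInf_le hmem
    _ ≤ 2 * (2 * ((m + 2 : ℕ) : ℝ)) ^ (2 : ℝ) := by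
        rw [Real.rpow_two]
        push_cast
        gcongr
        linarith [(Nat.cast_nonneg m : (0 : ℝ) ≤ m)]
    _ ≤ _ := by
        gcongr
        · linarith
        · nlinarith
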